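/- **Definitions.** All graphs are finite and simple. A *2-factor* of a graph $G$ is a spanning subgraph of $G$ in which every vertex has degree $2$; a 2-factor is *odd* if all its cycles have odd length. Two edges are *independent* if they have no common end. A pair of independent edges $f=ab$, $g=cd$ of a graph $R$ is a *gadget-pair* of $R$ if 1. no 2-factor of $R$ avoids both $f$ and $g$; 2. every 2-factor of $R$ containing exactly one of $f,g$ is odd; 3. every 2-factor of $R$ containing both $f$ and $g$ is odd, and $f$ and $g$ lie on different cycles of it; 4. in every 2-factor of $(R-\{f,g\})\cup\{ac,ad,bc,bd\}$ that contains exactly one edge $e$ of $\{ac,ad,bc,bd\}$, the cycle containing $e$ has even length and all other cycles have odd length. The graph $P_{18}$ (the snark Blanuša 2) has vertex set $\{1,\dots,18\}$ and edges (1,2), (1,4), (2,3), (2,6), (3,8), (4,5), (4,8), (5,6), (6,7), (7,8), (9,10), (9,14), (10,11), (10,12), (11,18), (12,13), (12,16), (13,14), (13,18), (14,15), (15,16), (16,17), (17,18), (1,9), (5,15), (7,17), (3,11). The graph $P_{26}$ has vertex set $\{1,\dots,26\}$ and edges (1,2), (2,3), (4,5), (5,6), (2,5), (7,8), (7,12),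 (8,9), (8,10), (9,16), (10,11), (10,14), (11,12), (11,16), (12,13), (13,14), (14,15), (15,16), (1,7), (3,13), (6,15), (4,9), (17,18), (17,22), (18,19), (18,20), (19,26), (20,21), (20,24), (21,22), (21,26), (22,23), (23,24), (24,25), (25,26), (3,17), (6,25), (4,23), (1,19). The graph $P_{34}$ has vertex set $\{1,\dots,34\}$ and edges (5,6), (5,10), (6,7), (6,8), (7,14), (8,9), (8,12), (9,10), (9,14), (10,11), (11,12), (12,13), (13,14), (1,5), (4,11), (3,13), (2,7), (15,16), (15,20), (16,17), (16,18), (17,24), (18,19), (18,22), (19,20), (19,24), (20,21), (21,22), (22,23), (23,24), (4,15), (3,23), (2,21), (1,17), (25,26), (25,34), (26,27), (26,28), (27,30), (28,29), (28,32), (29,30), (29,34), (30,31), (31,32), (32,33), (33,34), (2,33), (3,27), (4,31), (1,25). For odd $t\ge 5$ the *Flower snark* $J(t)$ has vertex set $\{h_i,u_i,v_i,w_i : 1\le i\le t\}$ and edge set $$\{h_iu_i,\,h_iv_i,\,h_iw_i : 1\le i\le t\}\ \cup\ \{u_ju_{j+1},\,v_jv_{j+1},\,w_jw_{j+1} : 1\le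 j\le t-1\}\ \cup\ \{u_tv_1,\,v_tu_1,\,w_tw_1\}.$$ **Lemma.** (i) None of the snarks $P_{18}$, $P_{26}$, $P_{34}$ has a gadget-pair. (ii) For every odd $t\ge 5$, the Flower snark $J(t)$ has no gadget-pair. -/

import Mathlib

namespace OddTwoFactor

/-- `F` is a 2-factor of `G`: a spanning subgraph of `G` in which every vertex has degree 2.
It is recorded by its edges, as a simple graph on the same vertex set. -/
def IsTwoFactor {V : Type*} (G F : SimpleGraph V) : Prop :=
  F ≤ G ∧ ∀ v : V, (F.neighborSet v).ncard = 2

/-- Every cycle of `F` has odd length. -/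
def AllCyclesOdd {V : Type*} (F : SimpleGraph V) : Prop :=
  ∀ (v : V) (p : F.Walk v v), p.IsCycle → Odd p.length

/-- The four possible edges joining an end of `ab` to an end of `cd`. -/
def crossEdges {V : Type*} (a b c d : V) : Set (Sym2 V) :=
  {s(a, c), s(a, d), s(b, c), s(b, d)}

/-- The graph `(R - {ab, cd}) ∪ {ac, ad, bc, bd}`. -/
def exchange {V : Type*} (R : SimpleGraph V) (a b c d : V) : SimpleGraph V :=
  R.deleteEdges {s(a, b), s(c, d)} ⊔ SimpleGraph.fromEdgeSet (crossEdges a b c d)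

/-- `ab` and `cd` form a gadget-pair of `R`. -/
structure IsGadgetPair {V : Type*} (R : SimpleGraph V) (a b c d : V) : Prop where
  adj_ab : R.Adj a b
  adj_cd : R.Adj c d
  /-- The two edges have no common end. -/
  independent : a ≠ c ∧ a ≠ d ∧ b ≠ c ∧ b ≠ d
  /-- No 2-factor avoids both edges. -/
  not_avoid : ∀ F : SimpleGraph V, IsTwoFactor R F →
    ¬ (s(a, b) ∉ F.edgeSet ∧ s(c, d) ∉ F.edgeSet)
  /-- All 2-factors with exactly one of the two edges are odd. -/
  exactly_one : ∀ F : SimpleGraph V, IsTwoFactor R F →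
    Xor (s(a, b) ∈ F.edgeSet) (s(c, d) ∈ F.edgeSet) → AllCyclesOdd F
  /-- All 2-factors with both edges are odd, and have the two edges on different cycles. -/
  both : ∀ F : SimpleGraph V, IsTwoFactor R F →
    s(a, b) ∈ F.edgeSet → s(c, d) ∈ F.edgeSet →
      AllCyclesOdd F ∧
      ∀ (v : V) (p : F.Walk v v), p.IsCycle → ¬ (s(a, b) ∈ p.edges ∧ s(c, d) ∈ p.edges)
  /-- In a 2-factor of the exchanged graph with exactly one cross edge `e`,
  the cycle through `e` is even and all other cycles are odd. -/
  cross : ∀ F : SimpleGraph V, IsTwoFactor (exchange R a b c d) F →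
    ∀ e : Sym2 V, F.edgeSet ∩ crossEdges a b c d = {e} →
      ∀ (v : V) (p : F.Walk v v), p.IsCycle →
        (e ∈ p.edges → Even p.length) ∧ (e ∉ p.edges → Odd p.length)

/-- `R` has a gadget-pair. -/
def HasGadgetPair {V : Type*} (R : SimpleGraph V) : Prop :=
  ∃ a b c d : V, IsGadgetPair R a b c d

/-- The graph with vertices labelled `1, …, n` (the vertex `i : Fin n` carries the label `i + 1`)
whose edges are the pairs of labels in `E`. -/
def labelledGraph (n : ℕ) (E : List (ℕ × ℕ)) : SimpleGraph (Fin n) :=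
  SimpleGraph.fromRel fun i j => (i.val + 1, j.val + 1) ∈ E

/-- The snark `P₁₈` (Blanuša 2), a dot product of two Petersen graphs. The first line is the
Petersen graph minus two adjacent vertices, the next two lines the Petersen graph minus two
independent edges, and the last line the four joining edges. -/
def P18 : SimpleGraph (Fin 18) :=
  labelledGraph 18
    [(1, 2), (1, 4), (2, 3), (2, 6), (3, 8), (4, 5), (4, 8), (5, 6), (6, 7), (7, 8),
     (9, 10), (9, 14), (10, 11), (10, 12), (11, 18), (12, 13), (12, 16), (13, 14), (13, 18),
     (14, 15), (15, 16), (16, 17), (17, 18),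
     (1, 9), (5, 15), (7, 17), (3, 11)]

/-- The snark `P₂₆`, a dot product of `P₁₈` and the Petersen graph. -/
def P26 : SimpleGraph (Fin 26) :=
  labelledGraph 26
    [(1, 2), (2, 3), (4, 5), (5, 6), (2, 5),
     (7, 8), (7, 12), (8, 9), (8, 10), (9, 16), (10, 11), (10, 14), (11, 12), (11, 16),
     (12, 13), (13, 14), (14, 15), (15, 16),
     (1, 7), (3, 13), (6, 15), (4, 9),
     (17, 18), (17, 22), (18, 19), (18, 20), (19, 26), (20, 21), (20, 24), (21, 22), (21, 26),
     (22, 23), (23, 24), (24, 25), (25, 26),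
     (17, 3), (25, 6), (23, 4), (1, 19)]

/-- The snark `P₃₄`, a dot product of `P₂₆` and the Petersen graph. -/
def P34 : SimpleGraph (Fin 34) :=
  labelledGraph 34
    [(5, 6), (5, 10), (6, 7), (6, 8), (7, 14), (8, 9), (8, 12), (9, 10), (9, 14), (10, 11),
     (11, 12), (12, 13), (13, 14),
     (1, 5), (4, 11), (3, 13), (2, 7),
     (15, 16), (15, 20), (16, 17), (16, 18), (17, 24), (18, 19), (18, 22), (19, 20), (19, 24),
     (20, 21), (21, 22), (22, 23), (23, 24),
     (15, 4), (23, 3), (21, 2), (1, 17),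
     (25, 26), (25, 34), (26, 27), (26, 28), (27, 30), (28, 29), (28, 32), (29, 30), (29, 34),
     (30, 31), (31, 32), (32, 33), (33, 34),
     (33, 2), (27, 3), (31, 4), (1, 25)]

/-- The vertices `h_i, u_i, v_i, w_i` of the Flower snark `J(t)`; the index set
`{1, …, t}` is shifted to `{0, …, t - 1}`. -/
inductive FlowerVertex (t : ℕ) : Type
  | h (i : Fin t)
  | u (i : Fin t)
  | v (i : Fin t)
  | w (i : Fin t)

/-- The edges of the Flower snark, each in one orientation: spokes, links between consecutive
interchanges, and the twisted link from the last interchange back to the first. -/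
inductive FlowerEdge (t : ℕ) : FlowerVertex t → FlowerVertex t → Prop
  | hu (i : Fin t) : FlowerEdge t (.h i) (.u i)
  | hv (i : Fin t) : FlowerEdge t (.h i) (.v i)
  | hw (i : Fin t) : FlowerEdge t (.h i) (.w i)
  | uu (i j : Fin t) : i.val + 1 = j.val → FlowerEdge t (.u i) (.u j)
  | vv (i j : Fin t) : i.val + 1 = j.val → FlowerEdge t (.v i) (.v j)
  | ww (i j : Fin t) : i.val + 1 = j.val → FlowerEdge t (.w i) (.w j)
  | uv (i j : Fin t) : i.val + 1 = t → j.val = 0 → FlowerEdge t (.u i) (.v j)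
  | vu (i j : Fin t) : i.val + 1 = t → j.val = 0 → FlowerEdge t (.v i) (.u j)
  | wrap (i j : Fin t) : i.val + 1 = t → j.val = 0 → FlowerEdge t (.w i) (.w j)

/-- The Flower snark `J(t)` (intended for odd `t ≥ 5`). -/
def flowerSnark (t : ℕ) : SimpleGraph (FlowerVertex t) :=
  SimpleGraph.fromRel (FlowerEdge t)

end OddTwoFactor

/-
For `P₁₈`, `P₂₆` and `P₃₄`, every pair of independent edges is refuted by an explicit 2-factor,
given as a list of cycles: one that avoids both edges, one with both edges on the same cycle, or
one of the exchanged graph with a single cross edge, on an odd cycle.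

In the Flower snark, call the three links between consecutive interchanges a gap. Choosing one
link in every gap so that consecutive choices are not adjacent determines a perfect matching, since
each hub is matched to the remaining strand of its interchange. So a perfect matching through two
prescribed edges is a proper 3-colouring of the cycle of gaps, twisted by the permutations that
connect them, with prescribed colours or shorter lists of colours at a few places. Such a colouring
is found greedily, unless the two edges are links of the same gap, and the complement of the
matching is a 2-factor avoiding both edges. If the edges are links of the same gap, starting at
strands `a` and `c` of interchange `i`, then the triangle `h_i, a, c` is a cycle through the cross
edge `ac` of a 2-factor of the exchanged graph. The rest of that 2-factor uses alternately one and
two links in a gap, with one link on both sides of interchange `i`; this alternation closes up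
because the number of gaps is odd.
-/

namespace OddTwoFactor

section Exchange

variable {V : Type*} {R : SimpleGraph V} {a b c d : V}

theorem crossEdges_swap_left : crossEdges b a c d = crossEdges a b c d := by
  ext e; simp only [crossEdges, Set.mem_insert_iff, Set.mem_singleton_iff]; tauto

theorem crossEdges_comm : crossEdges c d a b = crossEdges a b c d := by
  ext e
  simp only [crossEdges, Set.mem_insert_iff, Set.mem_singleton_iff, Sym2.eq_swap (a := c),
    Sym2.eq_swap (a := d)]
  tauto

theorem exchange_swap_left : exchange R b a c d = exchange R a b c d := by
  rw [exchange, crossEdges_swap_left, Sym2.eq_swap, ← exchange]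

theorem exchange_comm : exchange R c d a b = exchange R a b c d := by
  rw [exchange, crossEdges_comm, Set.pair_comm, ← exchange]

theorem exchange_adj {v w : V} :
    (exchange R a b c d).Adj v w ↔
      R.Adj v w ∧ s(v, w) ≠ s(a, b) ∧ s(v, w) ≠ s(c, d) ∨ s(v, w) ∈ crossEdges a b c d ∧ v ≠ w := by
  rw [exchange, SimpleGraph.sup_adj, SimpleGraph.deleteEdges_adj, SimpleGraph.fromEdgeSet_adj,
    Set.mem_insert_iff, Set.mem_singleton_iff, not_or]

theorem IsGadgetPair.swap_left (h : IsGadgetPair R a b c d) : IsGadgetPair R b a c d where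
  adj_ab := h.adj_ab.symm
  adj_cd := h.adj_cd
  independent := by have := h.independent; tauto
  not_avoid := by rw [Sym2.eq_swap]; exact h.not_avoid
  exactly_one := by rw [Sym2.eq_swap]; exact h.exactly_one
  both := by rw [Sym2.eq_swap]; exact h.both
  cross := by rw [exchange_swap_left, crossEdges_swap_left]; exact h.cross

theorem IsGadgetPair.symm (h : IsGadgetPair R a b c d) : IsGadgetPair R c d a b where
  adj_ab := h.adj_cd
  adj_cd := h.adj_ab
  independent := by have := h.independent; simp only [ne_comm (a := c), ne_comm (a := d)]; tauto
  not_avoid F hF := fun hn => h.not_avoid F hF hn.symm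
  exactly_one F hF := fun hx => h.exactly_one F hF (by rwa [xor_comm])
  both F hF hc ha :=
    ⟨(h.both F hF ha hc).1, fun v p hp hn => (h.both F hF ha hc).2 v p hp hn.symm⟩
  cross := by rw [exchange_comm, crossEdges_comm]; exact h.cross

theorem IsGadgetPair.swap_right (h : IsGadgetPair R a b c d) : IsGadgetPair R a b d c :=
  h.symm.swap_left.symm

end Exchange

section CycleList

variable {α V : Type*}

/-- The arcs of the cycle that visits the entries of `l` in turn and returns to the first one. -/
def cycleArcs (l : List α) : List (α × α) := l.zip (l.rotate 1)

/-- `e` is an edge, in either orientation, of the cycle through the entries of `l`. -/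
def IsCycleEdge (l : List α) (e : α × α) : Prop := e ∈ cycleArcs l ∨ e.swap ∈ cycleArcs l

instance [DecidableEq α] {l : List α} {e : α × α} : Decidable (IsCycleEdge l e) :=
  inferInstanceAs (Decidable (_ ∨ _))

theorem mem_cycleArcs_iff {l : List α} {x y : α} :
    (x, y) ∈ cycleArcs l ↔ ∃ i j : Fin l.length, (i + 1) % l.length = j.val ∧
      l.get i = x ∧ l.get j = y := by
  rw [cycleArcs, List.mem_iff_getElem]
  simp only [List.getElem_zip, List.getElem_rotate, Prod.mk.injEq, List.length_zip,
    List.length_rotate, min_self]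
  constructor
  · rintro ⟨i, hi, rfl, rfl⟩
    exact ⟨⟨i, hi⟩, ⟨(i + 1) % l.length, Nat.mod_lt _ (by lia)⟩, rfl, rfl, rfl⟩
  · rintro ⟨i, j, hij, rfl, rfl⟩
    exact ⟨i, i.isLt, rfl, by simp [hij]⟩

theorem cycleArcs_map {β : Type*} (φ : α → β) (l : List α) :
    cycleArcs (l.map φ) = (cycleArcs l).map (Prod.map φ φ) := by
  rw [cycleArcs, ← List.map_rotate, List.zip_map, cycleArcs]

theorem cycleGraph_adj_iff_add_one_mod {n : ℕ} (hn : 2 ≤ n) {i j : Fin n} :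
    (SimpleGraph.cycleGraph n).Adj i j ↔ (i + 1) % n = j.val ∨ (j + 1) % n = i.val := by
  have key (i j : Fin n) : (i + 1) % n = j.val ↔ (j - i).val = 1 := by
    have : NeZero n := ⟨by lia⟩
    have : Nontrivial (Fin n) := Fin.nontrivial_iff_two_le.2 hn
    have h1 : (1 : Fin n).val = 1 := Fin.val_one' n ▸ Nat.mod_eq_of_lt hn
    rw [← h1, ← Fin.val_add, Fin.val_inj, Fin.val_inj, sub_eq_iff_eq_add', eq_comm]
  rw [SimpleGraph.cycleGraph_adj', key, key, or_comm]

theorem isCycleEdge_iff {l : List α} (hl : 2 ≤ l.length) {x y : α} :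
    IsCycleEdge l (x, y) ↔
      ∃ i j, (SimpleGraph.cycleGraph l.length).Adj i j ∧ l.get i = x ∧ l.get j = y := by
  simp only [IsCycleEdge, Prod.swap_prod_mk, mem_cycleArcs_iff, cycleGraph_adj_iff_add_one_mod hl]
  constructor
  · rintro (⟨i, j, h, hi, hj⟩ | ⟨i, j, h, hi, hj⟩)
    exacts [⟨i, j, .inl h, hi, hj⟩, ⟨j, i, .inr h, hj, hi⟩]
  · rintro ⟨i, j, h | h, hi, hj⟩
    exacts [.inl ⟨i, j, h, hi, hj⟩, .inr ⟨j, i, h, hj, hi⟩]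

theorem ncard_neighborSet_cycleGraph {n : ℕ} (hn : 3 ≤ n) (i : Fin n) :
    ((SimpleGraph.cycleGraph n).neighborSet i).ncard = 2 := by
  obtain ⟨n, rfl⟩ := Nat.exists_eq_add_of_le' hn
  rw [Set.ncard_eq_toFinset_card', ← SimpleGraph.neighborFinset_def,
    SimpleGraph.card_neighborFinset_eq_degree, SimpleGraph.cycleGraph_degree_three_le]

theorem mem_edges_cycleGraph_cycle {n : ℕ} {i j : Fin (n + 3)}
    (h : (SimpleGraph.cycleGraph (n + 3)).Adj i j) :
    s(i, j) ∈ (SimpleGraph.cycleGraph.cycle n).edges := by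
  rw [← SimpleGraph.Walk.adj_toSubgraph_iff_mem_edges,
    SimpleGraph.cycleGraph.isCycle_cycle.adj_toSubgraph_iff_of_isCycles
      (fun i _ => ncard_neighborSet_cycleGraph (by lia) i)]
  · exact h
  · rw [SimpleGraph.Walk.mem_verts_toSubgraph, SimpleGraph.Walk.mem_support_iff_exists_getVert]
    refine ⟨n + 3 - i, ?_, by simp⟩
    rw [SimpleGraph.cycleGraph.getVert_cycle (by lia)]
    ext
    simp [Nat.sub_sub_self i.isLt.le, Nat.mod_eq_of_lt i.isLt]

theorem exists_isCycle_of_injective_hom {F : SimpleGraph V} {n : ℕ} (hn : 3 ≤ n)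
    (φ : SimpleGraph.cycleGraph n →g F) (hφ : Function.Injective φ) :
    ∃ (v : V) (p : F.Walk v v), p.IsCycle ∧ p.length = n ∧
      ∀ i j, (SimpleGraph.cycleGraph n).Adj i j → s(φ i, φ j) ∈ p.edges := by
  obtain ⟨n, rfl⟩ := Nat.exists_eq_add_of_le' hn
  refine ⟨_, (SimpleGraph.cycleGraph.cycle n).map φ,
    (SimpleGraph.Walk.isCycle_map_iff_of_injective hφ).2 SimpleGraph.cycleGraph.isCycle_cycle,
    by simp, fun i j hij => ?_⟩
  rw [SimpleGraph.Walk.edges_map]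
  exact List.mem_map_of_mem (mem_edges_cycleGraph_cycle hij)

/-- The graph formed by the edges of the cycles through the lists in `C`. -/
def cyclesGraph (C : List (List V)) : SimpleGraph V where
  Adj x y := x ≠ y ∧ ∃ l ∈ C, IsCycleEdge l (x, y)
  symm := ⟨fun _ _ h => ⟨h.1.symm, h.2.imp fun _ h => ⟨h.1, h.2.symm⟩⟩⟩
  loopless := ⟨fun _ h => h.1 rfl⟩

theorem cyclesGraph_adj {C : List (List V)} {x y : V} :
    (cyclesGraph C).Adj x y ↔ x ≠ y ∧ ∃ l ∈ C, IsCycleEdge l (x, y) := Iff.rfl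

/-- The cycles through the lists in `C` partition `V`; they are recorded by their vertices in
cyclic order. -/
structure IsCycleCover (C : List (List V)) : Prop where
  three_le_length : ∀ l ∈ C, 3 ≤ l.length
  nodup : C.flatten.Nodup
  mem_flatten : ∀ v, v ∈ C.flatten

namespace IsCycleCover

variable {C : List (List V)} {R : SimpleGraph V} {l : List V} {a b c d : V}

theorem nodup_of_mem (hC : IsCycleCover C) (hl : l ∈ C) : l.Nodup :=
  (List.nodup_flatten.1 hC.nodup).1 l hl

theorem eq_of_mem (hC : IsCycleCover C) {l' : List V} (hl : l ∈ C) (hl' : l' ∈ C) {v : V}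
    (hv : v ∈ l) (hv' : v ∈ l') : l = l' := by
  by_contra h
  have : Std.Symm (List.Disjoint (α := V)) := ⟨fun _ _ => List.Disjoint.symm⟩
  exact (List.nodup_flatten.1 hC.nodup).2.forall hl hl' h hv hv'

theorem neighborSet_cyclesGraph (hC : IsCycleCover C) (hl : l ∈ C) (i : Fin l.length) :
    (cyclesGraph C).neighborSet (l.get i) =
      l.get '' (SimpleGraph.cycleGraph l.length).neighborSet i := by
  have hlen (l) (hl : l ∈ C) : 2 ≤ l.length := by have := hC.three_le_length l hl; lia
  have hinj := List.nodup_iff_injective_get.1 (hC.nodup_of_mem hl)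
  ext w
  simp only [SimpleGraph.mem_neighborSet, cyclesGraph_adj, Set.mem_image]
  constructor
  · rintro ⟨-, l', hl', hw⟩
    obtain ⟨i', j, hij, hi, rfl⟩ := (isCycleEdge_iff (hlen l' hl')).1 hw
    obtain rfl := hC.eq_of_mem hl hl' (List.get_mem l i) (hi ▸ List.get_mem l' i')
    exact ⟨j, hinj hi ▸ hij, rfl⟩
  · rintro ⟨j, hij, rfl⟩
    exact ⟨hinj.ne hij.ne, l, hl, (isCycleEdge_iff (hlen l hl)).2 ⟨i, j, hij, rfl, rfl⟩⟩

theorem isTwoFactor (hC : IsCycleCover C) (hR : cyclesGraph C ≤ R) :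
    IsTwoFactor R (cyclesGraph C) := by
  refine ⟨hR, fun v => ?_⟩
  obtain ⟨l, hl, hv⟩ := List.mem_flatten.1 (hC.mem_flatten v)
  obtain ⟨i, rfl⟩ := List.get_of_mem hv
  rw [hC.neighborSet_cyclesGraph hl, Set.ncard_image_of_injective _
    (List.nodup_iff_injective_get.1 (hC.nodup_of_mem hl)),
    ncard_neighborSet_cycleGraph (hC.three_le_length l hl)]

theorem adj_of_isCycleEdge (hC : IsCycleCover C) (hl : l ∈ C) {x y : V}
    (h : IsCycleEdge l (x, y)) : (cyclesGraph C).Adj x y := by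
  obtain ⟨i, j, hij, rfl, rfl⟩ :=
    (isCycleEdge_iff ((hC.three_le_length l hl).trans' (by lia))).1 h
  exact (hC.neighborSet_cyclesGraph hl i).ge ⟨j, hij, rfl⟩

theorem exists_isCycle (hC : IsCycleCover C) (hl : l ∈ C) :
    ∃ (v : V) (p : (cyclesGraph C).Walk v v), p.IsCycle ∧ p.length = l.length ∧
      ∀ x y, IsCycleEdge l (x, y) → s(x, y) ∈ p.edges := by
  have hlen := hC.three_le_length l hl
  obtain ⟨v, p, hp, hpl, hedge⟩ := exists_isCycle_of_injective_hom hlen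
    ⟨l.get, fun h => hC.adj_of_isCycleEdge hl ((isCycleEdge_iff (by lia)).2 ⟨_, _, h, rfl, rfl⟩)⟩
    (List.nodup_iff_injective_get.1 (hC.nodup_of_mem hl))
  refine ⟨v, p, hp, hpl, fun x y hxy => ?_⟩
  obtain ⟨i, j, hij, rfl, rfl⟩ := (isCycleEdge_iff (by lia)).1 hxy
  exact hedge i j hij

theorem not_isGadgetPair_of_avoid (hC : IsCycleCover C) (hR : cyclesGraph C ≤ R)
    (h : ∀ l ∈ C, ¬ IsCycleEdge l (a, b) ∧ ¬ IsCycleEdge l (c, d)) :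
    ¬ IsGadgetPair R a b c d := fun hg =>
  hg.not_avoid _ (hC.isTwoFactor hR) <| by
    simp only [SimpleGraph.mem_edgeSet, cyclesGraph_adj, not_and, not_exists]
    exact ⟨fun _ l hl => (h l hl).1, fun _ l hl => (h l hl).2⟩

theorem not_isGadgetPair_of_same_cycle (hC : IsCycleCover C) (hR : cyclesGraph C ≤ R) (hl : l ∈ C)
    (hab : IsCycleEdge l (a, b)) (hcd : IsCycleEdge l (c, d)) : ¬ IsGadgetPair R a b c d := by
  intro hg
  obtain ⟨v, p, hp, -, hedge⟩ := hC.exists_isCycle hl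
  exact (hg.both _ (hC.isTwoFactor hR) (hC.adj_of_isCycleEdge hl hab)
    (hC.adj_of_isCycleEdge hl hcd)).2 v p hp ⟨hedge a b hab, hedge c d hcd⟩

theorem not_isGadgetPair_of_cross (hC : IsCycleCover C) (hl : l ∈ C) (hodd : Odd l.length)
    {x y : V} (hx : x ∈ [a, b]) (hy : y ∈ [c, d]) (hxy : (x, y) ∈ cycleArcs l)
    (hR : ∀ l ∈ C, ∀ e ∈ cycleArcs l,
      e = (x, y) ∨ R.Adj e.1 e.2 ∧ ¬ (e.1 ∈ [a, b, c, d] ∧ e.2 ∈ [a, b, c, d])) :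
    ¬ IsGadgetPair R a b c d := by
  intro hg
  set S : List V := [a, b, c, d] with hS
  have mem_S (v w : V) (hvw : s(v, w) = s(a, b) ∨ s(v, w) = s(c, d) ∨
      s(v, w) ∈ crossEdges a b c d) : v ∈ S ∧ w ∈ S := by
    simp only [hS, crossEdges, Set.mem_insert_iff, Set.mem_singleton_iff, Sym2.eq_iff] at hvw ⊢
    grind
  have hcross : s(x, y) ∈ crossEdges a b c d := by
    simp only [crossEdges, Set.mem_insert_iff, Set.mem_singleton_iff]
    grind
  have hF (v w : V) (h : (cyclesGraph C).Adj v w) :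
      s(v, w) = s(x, y) ∨ R.Adj v w ∧ ¬ (v ∈ S ∧ w ∈ S) := by
    obtain ⟨-, l', hl', h | h⟩ := h
    · exact (hR l' hl' _ h).imp (by simp +contextual) id
    · exact (hR l' hl' _ h).imp (by simp +contextual [Sym2.eq_swap]) fun h => ⟨h.1.symm, by tauto⟩
  have hexch : cyclesGraph C ≤ exchange R a b c d := fun v w h => by
    rw [exchange_adj]
    obtain hvw | ⟨hvw, hS⟩ := hF v w h
    · exact .inr ⟨hvw ▸ hcross, h.ne⟩
    · exact .inl ⟨hvw, fun h => hS (mem_S v w (.inl h)), fun h => hS (mem_S v w (.inr (.inl h)))⟩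
  have hinter : (cyclesGraph C).edgeSet ∩ crossEdges a b c d = {s(x, y)} := by
    refine Set.Subset.antisymm ?_ (Set.singleton_subset_iff.2
      ⟨hC.adj_of_isCycleEdge hl (.inl hxy), hcross⟩)
    rintro ⟨v, w⟩ ⟨hvw, hc⟩
    exact (hF v w hvw).resolve_right fun h => h.2 (mem_S v w (.inr (.inr hc)))
  obtain ⟨v, p, hp, hlen, hedge⟩ := hC.exists_isCycle hl
  have heven := (hg.cross _ (hC.isTwoFactor hexch) _ hinter v p hp).1 (hedge x y (.inl hxy))
  exact Nat.not_even_iff_odd.2 hodd (hlen ▸ heven)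

end IsCycleCover

end CycleList

section LabelledGraph

variable {n : ℕ} {E : List (ℕ × ℕ)} {C : List (List ℕ)}

/-- The label carried by a vertex of `labelledGraph n E`. -/
def label (i : Fin n) : ℕ := i.val + 1

theorem label_injective : Function.Injective (label (n := n)) :=
  fun _ _ h => Fin.ext (Nat.succ_injective h)

theorem labelledGraph_adj {i j : Fin n} : (labelledGraph n E).Adj i j ↔
    i ≠ j ∧ ((label i, label j) ∈ E ∨ (label j, label i) ∈ E) :=
  SimpleGraph.fromRel_adj ..

/-- The cycles through the lists in `C` partition the labels `1, …, n`. -/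
def IsLabelCover (n : ℕ) (C : List (List ℕ)) : Prop :=
  (∀ l ∈ C, 3 ≤ l.length) ∧ C.flatten.Perm (List.range' 1 n)

instance : Decidable (IsLabelCover n C) := inferInstanceAs (Decidable (_ ∧ _))

theorem IsLabelCover.exists_isCycleCover (hC : IsLabelCover n C) :
    ∃ D : List (List (Fin n)), D.map (List.map label) = C ∧ IsCycleCover D := by
  have hrange (k : ℕ) : k ∈ C.flatten ↔ ∃ i : Fin n, label i = k := by
    rw [hC.2.mem_iff, List.mem_range'_1]
    exact ⟨fun h => ⟨⟨k - 1, by lia⟩, by simp only [label]; lia⟩,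
      fun ⟨i, hi⟩ => by simp only [label] at hi; lia⟩
  obtain ⟨D, rfl⟩ : C ∈ Set.range (List.map (List.map (label (n := n)))) := by
    simp only [Set.range_list_map, Set.mem_ofPred_eq, Set.mem_range]
    exact fun l hl k hk => (hrange k).1 (List.mem_flatten.2 ⟨l, hl, hk⟩)
  refine ⟨D, rfl, fun l hl => by simpa using hC.1 _ (List.mem_map_of_mem hl), ?_, fun i => ?_⟩
  · exact .of_map label (List.map_flatten ▸ hC.2.nodup_iff.2 List.nodup_range')
  · simpa [label_injective.eq_iff] using (hrange (label i)).2 ⟨i, rfl⟩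

theorem mem_cycleArcs_map_label {l : List (Fin n)} {x y : Fin n} :
    (label x, label y) ∈ cycleArcs (l.map label) ↔ (x, y) ∈ cycleArcs l := by
  rw [cycleArcs_map, ← List.mem_map_of_injective (label_injective.prodMap label_injective)]
  rfl

theorem isCycleEdge_map_label {l : List (Fin n)} {x y : Fin n} :
    IsCycleEdge (l.map label) (label x, label y) ↔ IsCycleEdge l (x, y) :=
  or_congr mem_cycleArcs_map_label mem_cycleArcs_map_label

/-- Every arc of the cycles in `C` is, up to orientation, in `E`. -/
def HasArcsIn (E : List (ℕ × ℕ)) (C : List (List ℕ)) : Prop :=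
  ∀ l ∈ C, ∀ e ∈ cycleArcs l, e ∈ E ∨ e.swap ∈ E

instance : Decidable (HasArcsIn E C) := inferInstanceAs (Decidable (∀ _ ∈ _, _))

/-- The cycles in `C` either avoid both `f` and `g`, or have both on one cycle. -/
def AvoidsOrLinks (C : List (List ℕ)) (f g : ℕ × ℕ) : Prop :=
  (∀ l ∈ C, ¬ IsCycleEdge l f ∧ ¬ IsCycleEdge l g) ∨ ∃ l ∈ C, IsCycleEdge l f ∧ IsCycleEdge l g

instance {f g : ℕ × ℕ} : Decidable (AvoidsOrLinks C f g) := inferInstanceAs (Decidable (_ ∨ _))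

/-- Some odd cycle in `C` has an arc joining an end of `f` to an end of `g`, and all other arcs
are in `E` and do not join two ends of `f` and `g`. -/
def CrossesOnce (E : List (ℕ × ℕ)) (C : List (List ℕ)) (f g : ℕ × ℕ) : Prop :=
  ∃ l ∈ C, Odd l.length ∧ ∃ x ∈ [f.1, f.2], ∃ y ∈ [g.1, g.2], (x, y) ∈ cycleArcs l ∧
    ∀ l' ∈ C, ∀ e ∈ cycleArcs l', e = (x, y) ∨ (e ∈ E ∨ e.swap ∈ E) ∧
      ¬ (e.1 ∈ [f.1, f.2, g.1, g.2] ∧ e.2 ∈ [f.1, f.2, g.1, g.2])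

instance {f g : ℕ × ℕ} : Decidable (CrossesOnce E C f g) :=
  inferInstanceAs (Decidable (∃ _ ∈ _, _))

theorem IsLabelCover.not_isGadgetPair_of_avoidsOrLinks (hC : IsLabelCover n C)
    (hE : HasArcsIn E C) {a b c d : Fin n}
    (h : AvoidsOrLinks C (label a, label b) (label c, label d)) :
    ¬ IsGadgetPair (labelledGraph n E) a b c d := by
  obtain ⟨D, rfl, hD⟩ := hC.exists_isCycleCover
  have hR : cyclesGraph D ≤ labelledGraph n E := by
    rintro x y ⟨hne, l, hl, hxy | hxy⟩
    · exact labelledGraph_adj.2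
        ⟨hne, hE _ (List.mem_map_of_mem hl) _ (mem_cycleArcs_map_label.2 hxy)⟩
    · exact labelledGraph_adj.2
        ⟨hne, (hE _ (List.mem_map_of_mem hl) _ (mem_cycleArcs_map_label.2 hxy)).symm⟩
  simp only [AvoidsOrLinks, List.mem_map, forall_exists_index, and_imp, forall_apply_eq_imp_iff₂,
    exists_exists_and_eq_and, isCycleEdge_map_label] at h
  obtain h | ⟨l, hl, hab, hcd⟩ := h
  · exact hD.not_isGadgetPair_of_avoid hR h
  · exact hD.not_isGadgetPair_of_same_cycle hR hl hab hcd

theorem IsLabelCover.not_isGadgetPair_of_crossesOnce (hC : IsLabelCover n C) {a b c d : Fin n}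
    (h : CrossesOnce E C (label a, label b) (label c, label d)) :
    ¬ IsGadgetPair (labelledGraph n E) a b c d := by
  obtain ⟨D, rfl, hD⟩ := hC.exists_isCycleCover
  obtain ⟨l', hl', hodd, x', hx', y', hy', hxy, hE⟩ := h
  obtain ⟨l, hl, rfl⟩ := List.mem_map.1 hl'
  obtain ⟨x, hx, rfl⟩ : ∃ x ∈ [a, b], label x = x' := List.mem_map.1 hx'
  obtain ⟨y, hy, rfl⟩ : ∃ y ∈ [c, d], label y = y' := List.mem_map.1 hy'
  refine hD.not_isGadgetPair_of_cross hl (by simpa using hodd) hx hy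
    (mem_cycleArcs_map_label.1 hxy) fun l hl e he => ?_
  have hS (v : Fin n) : v ∈ [a, b, c, d] ↔ label v ∈ [a, b, c, d].map label :=
    (List.mem_map_of_injective label_injective).symm
  obtain h | ⟨hadj, h⟩ := hE _ (List.mem_map_of_mem hl) _ (mem_cycleArcs_map_label.2 he)
  · exact .inl (label_injective.prodMap label_injective h)
  · refine .inr ⟨labelledGraph_adj.2 ⟨(hD.adj_of_isCycleEdge hl (.inl he)).ne, hadj⟩, ?_⟩
    rwa [hS, hS]

theorem not_hasGadgetPair_labelledGraph (T X : List (List (List ℕ)))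
    (hT : ∀ C ∈ T, IsLabelCover n C ∧ HasArcsIn E C) (hX : ∀ C ∈ X, IsLabelCover n C)
    (hE : E.Pairwise fun f g => (f.1 ∈ [g.1, g.2] ∨ f.2 ∈ [g.1, g.2]) ∨
      (∃ C ∈ T, AvoidsOrLinks C f g) ∨ ∃ C ∈ X, CrossesOnce E C f g) :
    ¬ HasGadgetPair (labelledGraph n E) := by
  have key {a b c d : Fin n} (hab : (label a, label b) ∈ E) (hcd : (label c, label d) ∈ E) :
      ¬ IsGadgetPair (labelledGraph n E) a b c d := by
    let S (f g : ℕ × ℕ) : Prop := ∀ {a b c d : Fin n}, f = (label a, label b) →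
      g = (label c, label d) → ¬ IsGadgetPair (labelledGraph n E) a b c d
    have : Std.Symm S := ⟨fun _ _ h _ _ _ _ hf hg hp => h hg hf hp.symm⟩
    suffices ∀ f ∈ E, ∀ g ∈ E, S f g from this _ hab _ hcd rfl rfl
    refine fun f hf g hg => List.Pairwise.forall_of_forall (R := S) (fun f _ => ?_) ?_ hf hg
    · rintro a b c d rfl hcd h
      exact h.independent.1 (label_injective (congrArg Prod.fst hcd))
    refine hE.imp ?_
    rintro _ _ (hne | ⟨C, hC, h⟩ | ⟨C, hC, h⟩) a b c d rfl rfl hp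
    · have := hp.independent
      simp only [List.mem_cons, label_injective.eq_iff, List.not_mem_nil, or_false] at hne
      tauto
    · exact (hT C hC).1.not_isGadgetPair_of_avoidsOrLinks (hT C hC).2 h hp
    · exact (hX C hC).not_isGadgetPair_of_crossesOnce h hp
  rintro ⟨a, b, c, d, h⟩
  obtain ⟨-, hab | hab⟩ := labelledGraph_adj.1 h.adj_ab <;>
    obtain ⟨-, hcd | hcd⟩ := labelledGraph_adj.1 h.adj_cd
  · exact key hab hcd h
  · exact key hab hcd h.swap_right
  · exact key hab hcd h.swap_left
  · exact key hab hcd h.swap_left.swap_right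

end LabelledGraph

section Snarks

theorem not_hasGadgetPair_P18 : ¬ HasGadgetPair P18 :=
  not_hasGadgetPair_labelledGraph
    [[[1, 4, 5, 15, 16, 17, 18, 11, 3, 8, 7, 6, 2], [9, 10, 12, 13, 14]],
     [[1, 4, 5, 15, 14, 13, 12, 16, 17, 18, 11, 10, 9], [2, 3, 8, 7, 6]],
     [[1, 4, 5, 6, 2], [3, 8, 7, 17, 18, 13, 12, 16, 15, 14, 9, 10, 11]],
     [[1, 4, 8, 3, 2], [5, 15, 14, 9, 10, 11, 18, 13, 12, 16, 17, 7, 6]],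
     [[1, 9, 10, 12, 13, 14, 15, 16, 17, 18, 11, 3, 2], [4, 5, 6, 7, 8]],
     [[1, 4, 5, 6, 2, 3, 8, 7, 17, 16, 15, 14, 9], [10, 12, 13, 18, 11]],
     [[1, 9, 10, 12, 16, 17, 7, 6, 2], [3, 8, 4, 5, 15, 14, 13, 18, 11]],
     [[1, 4, 8, 7, 17, 16, 12, 10, 9], [2, 3, 11, 18, 13, 14, 15, 5, 6]],
     [[1, 4, 8, 7, 6, 5, 15, 14, 9, 10, 11, 3, 2], [12, 13, 18, 17, 16]]]
    [[[2, 4, 1], [3, 8, 7, 6, 5, 15, 16, 17, 18, 11], [9, 10, 12, 13, 14]],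
     [[2, 12, 10, 11, 3], [1, 4, 8, 7, 6, 5, 15, 16, 17, 18, 13, 14, 9]],
     [[4, 13, 14, 9, 1], [2, 3, 8, 7, 17, 18, 11, 10, 12, 16, 15, 5, 6]]]
    (by decide +kernel) (by decide +kernel) (by decide +kernel)

theorem not_hasGadgetPair_P26 : ¬ HasGadgetPair P26 :=
  not_hasGadgetPair_labelledGraph
    [[[1, 7, 12, 11, 16, 15, 6, 25, 26, 19, 18, 17, 3, 13, 14, 10, 8, 9, 4, 5, 2],
      [20, 24, 23, 22, 21]],
     [[1, 7, 12, 13, 14, 15, 6, 5, 4, 23, 22, 21, 20, 24, 25, 26, 19, 18, 17, 3, 2],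
      [8, 10, 11, 16, 9]],
     [[1, 7, 12, 13, 14, 15, 16, 11, 10, 8, 9, 4, 5, 6, 25, 24, 23, 22, 17, 3, 2],
      [18, 19, 26, 21, 20]],
     [[1, 7, 8, 9, 16, 15, 6, 5, 4, 23, 24, 25, 26, 19, 18, 20, 21, 22, 17, 3, 2],
      [10, 11, 12, 13, 14]],
     [[1, 7, 12, 13, 14, 15, 6, 25, 26, 21, 22, 17, 3, 2, 5, 4, 23, 24, 20, 18, 19],
      [8, 10, 11, 16, 9]],
     [[1, 19, 18, 17, 22, 23, 4, 5, 6, 15, 16, 9, 8, 7, 12, 11, 10, 14, 13, 3, 2],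
      [20, 24, 25, 26, 21]],
     [[1, 7, 8, 10, 14, 15, 6, 25, 24, 23, 22, 17, 18, 20, 21, 26, 19],
      [2, 3, 13, 12, 11, 16, 9, 4, 5]],
     [[1, 7, 8, 10, 14, 15, 6, 5, 2, 3, 13, 12, 11, 16, 9, 4, 23, 24, 25, 26, 19],
      [17, 18, 20, 21, 22]],
     [[1, 19, 18, 20, 24, 23, 4, 9, 16, 15, 14, 13, 3, 17, 22, 21, 26, 25, 6, 5, 2],
      [7, 8, 10, 11, 12]],
     [[1, 7, 12, 11, 16, 15, 6, 25, 26, 21, 20, 24, 23, 22, 17, 18, 19],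
      [2, 3, 13, 14, 10, 8, 9, 4, 5]]]
    [[[2, 11, 12, 13, 3],
      [1, 7, 8, 10, 14, 15, 16, 9, 4, 5, 6, 25, 26, 21, 20, 24, 23, 22, 17, 18, 19]],
     [[2, 20, 18, 17, 3],
      [1, 7, 8, 10, 11, 12, 13, 14, 15, 16, 9, 4, 5, 6, 25, 24, 23, 22, 21, 26, 19]],
     [[10, 20, 18, 19, 1, 7, 8],
      [2, 3, 17, 22, 21, 26, 25, 24, 23, 4, 9, 16, 11, 12, 13, 14, 15, 6, 5]]]
    (by decide +kernel) (by decide +kernel) (by decide +kernel)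

theorem not_hasGadgetPair_P34 : ¬ HasGadgetPair P34 :=
  not_hasGadgetPair_labelledGraph
    [[[1, 17, 24, 23, 22, 21, 20, 19, 18, 16, 15, 4, 11, 10, 9, 14, 7, 2, 33, 34, 25, 26, 27, 3,
       13, 12, 8, 6, 5],
      [28, 29, 30, 31, 32]],
     [[1, 25, 26, 27, 30, 31, 32, 28, 29, 34, 33, 2, 7, 6, 8, 12, 11, 4, 15, 16, 17, 24, 23, 3,
       13, 14, 9, 10, 5],
      [18, 22, 21, 20, 19]],
     [[1, 25, 26, 28, 32, 31, 4, 15, 20, 19, 18, 16, 17, 24, 23, 22, 21, 2, 33, 34, 29, 30, 27, 3,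
       13, 12, 11, 10, 5],
      [6, 7, 14, 9, 8]],
     [[1, 17, 16, 15, 20, 21, 2, 7, 6, 8, 12, 11, 4, 31, 32, 33, 34, 25, 26, 28, 29, 30, 27, 3,
       13, 14, 9, 10, 5],
      [18, 22, 23, 24, 19]],
     [[1, 17, 16, 18, 22, 21, 2, 33, 34, 25, 26, 27, 30, 29, 28, 32, 31, 4, 15, 20, 19, 24, 23, 3,
       13, 14, 7, 6, 5],
      [8, 12, 11, 10, 9]],
     [[1, 25, 34, 33, 32, 31, 4, 15, 20, 19, 24, 23, 3, 13, 12, 11, 10, 5, 6, 8, 9, 14, 7, 2, 21,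
       22, 18, 16, 17],
      [26, 27, 30, 29, 28]],
     [[1, 25, 26, 28, 32, 31, 4, 11, 10, 9, 8, 12, 13, 14, 7, 6, 5],
      [2, 21, 22, 18, 19, 20, 15, 16, 17, 24, 23, 3, 27, 30, 29, 34, 33]],
     [[1, 25, 34, 29, 30, 31, 4, 11, 12, 8, 9, 10, 5, 6, 7, 14, 13, 3, 27, 26, 28, 32, 33, 2, 21,
       20, 15, 16, 17],
      [18, 22, 23, 24, 19]]]
    [[[8, 18, 16, 15, 4, 11, 12],
      [1, 25, 34, 29, 28, 26, 27, 30, 31, 32, 33, 2, 7, 6, 5, 10, 9, 14, 13, 3, 23, 22, 21, 20,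
       19, 24, 17]],
     [[8, 28, 32, 31, 4, 11, 12],
      [1, 25, 26, 27, 30, 29, 34, 33, 2, 7, 6, 5, 10, 9, 14, 13, 3, 23, 24, 19, 18, 22, 21, 20,
       15, 16, 17]],
     [[18, 28, 26, 25, 1, 17, 16],
      [2, 21, 22, 23, 24, 19, 20, 15, 4, 31, 32, 33, 34, 29, 30, 27, 3, 13, 14, 9, 8, 12, 11, 10,
       5, 6, 7]]]
    (by decide +kernel) (by decide +kernel) (by decide +kernel)

end Snarks

section ListColoring

variable {α : Type*}

theorem exists_forall_mem_and_apply_ne (π : ℕ → Equiv.Perm α) (L : ℕ → Set α) (k : ℕ)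
    (hk : (L k).Nonempty) (hL : ∀ j ≠ k, (L j).Nontrivial) :
    ∃ c : ℕ → α, (∀ j, c j ∈ L j) ∧ ∀ j, π j (c j) ≠ c (j + 1) := by
  induction k generalizing π L with
  | zero =>
    obtain ⟨a, ha⟩ := hk
    have hnext (j : ℕ) (a : α) : ∃ b ∈ L (j + 1), b ≠ π j a :=
      (hL (j + 1) j.succ_ne_zero).exists_ne _
    choose next hmem hne using hnext
    refine ⟨fun j => Nat.rec a next j, fun j => ?_, fun j => (hne j _).symm⟩
    cases j
    exacts [ha, hmem _ _]
  | succ k ih =>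
    obtain ⟨c, hmem, hne⟩ := ih (fun j => π (j + 1)) (fun j => L (j + 1)) hk
      fun j hj => hL _ (by lia)
    obtain ⟨a, ha, hac⟩ := (hL 0 k.succ_ne_zero.symm).exists_ne ((π 0).symm (c 0))
    refine ⟨fun j => Nat.casesOn j a c, fun j => ?_, fun j => ?_⟩ <;> cases j
    exacts [ha, hmem _, fun h => hac ((π 0).eq_symm_apply.2 h), hne _]

variable {n : ℕ} [NeZero n]

/-- `x` is a proper colouring of the cycle `0, 1, …, n - 1`, where properness on the edge from `i`
to `i + 1` is twisted by the permutation `π i` of the colours. -/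
def IsTwistedColoring (π : Fin n → Equiv.Perm α) (x : Fin n → α) : Prop :=
  ∀ i, π i (x i) ≠ x (i + 1)

theorem val_add_one_of_add_one_ne_zero {i : Fin n} (hi : i + 1 ≠ 0) : (i + 1).val = i.val + 1 := by
  have hne : (i + 1).val ≠ 0 := fun h => hi (Fin.ext h)
  rw [Fin.val_add, Fin.val_one', Nat.add_mod_mod] at hne ⊢
  have : i.val + 1 ≠ n := fun h => hne (by rw [h, Nat.mod_self])
  exact Nat.mod_eq_of_lt (by lia)

theorem add_one_ne_self (hn : 2 ≤ n) (i : Fin n) : i + 1 ≠ i := by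
  rw [Ne, add_eq_left, Fin.one_eq_zero_iff]
  lia

theorem add_one_add_one_ne_self (hn : 3 ≤ n) (i : Fin n) : i + 1 + 1 ≠ i := by
  rw [Ne, add_assoc, add_eq_left, ← Fin.val_inj, Fin.val_add, Fin.val_one',
    Nat.mod_eq_of_lt (show 1 < n by lia), Nat.mod_eq_of_lt (show 1 + 1 < n by lia)]
  simp

theorem exists_forall_ne_mem_and_apply_ne [Nontrivial α] (π : Fin n → Equiv.Perm α)
    (L : Fin n → Set α) (k i : Fin n) (hi : (L i).Nonempty)
    (hL : ∀ j ≠ i, j ≠ k → (L j).Nontrivial) :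
    ∃ x : Fin n → α, (∀ j ≠ k, x j ∈ L j) ∧ ∀ j ≠ k, π j (x j) ≠ x (j + 1) := by
  let pos (j : Fin n) : ℕ := (j - (k + 1)).val
  have hpos : Function.Injective pos := Fin.val_injective.comp sub_left_injective
  have hsucc (j : Fin n) (hj : j ≠ k) : pos (j + 1) = pos j + 1 := by
    have h : j + 1 - (k + 1) = j - (k + 1) + 1 := by abel
    simp only [pos, h]
    exact val_add_one_of_add_one_ne_zero (h ▸ sub_ne_zero.2 (mt add_right_cancel hj))
  have hsubset (j : Fin n) : L j ⊆ {a | ∀ j', pos j' = pos j → j' ≠ k → a ∈ L j'} :=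
    fun a ha j' hj' _ => hpos hj' ▸ ha
  obtain ⟨c, hmem, hne⟩ := exists_forall_mem_and_apply_ne
    (fun m => π (Fin.ofNat n m + (k + 1)))
    (fun m => {a | ∀ j, pos j = m → j ≠ k → a ∈ L j}) (pos i) (hi.mono (hsubset i))
    fun m hm => by
      by_cases h : ∃ j ≠ k, pos j = m
      · obtain ⟨j, hj, rfl⟩ := h
        exact (hL j (fun h => hm (h ▸ rfl)) hj).mono (hsubset j)
      · exact Set.nontrivial_univ.mono fun a _ j hj hjk => (h ⟨j, hjk, hj⟩).elim
  refine ⟨c ∘ pos, fun j hj => hmem _ j rfl hj, fun j hj => ?_⟩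
  simpa [pos, ← hsucc j hj] using hne (pos j)

theorem isTwistedColoring_update (hn : 2 ≤ n) {π : Fin n → Equiv.Perm α} {x : Fin n → α}
    {k : Fin n} {a : α} (hx : ∀ j ≠ k, j + 1 ≠ k → π j (x j) ≠ x (j + 1))
    (hpred : ∀ j, j + 1 = k → π j (x j) ≠ a) (hsucc : π k a ≠ x (k + 1)) :
    IsTwistedColoring π (Function.update x k a) := by
  intro j
  by_cases hj : j = k
  · subst hj
    rwa [Function.update_self, Function.update_of_ne (add_one_ne_self hn j)]
  rw [Function.update_of_ne hj]
  by_cases hjk : j + 1 = k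
  · rw [hjk, Function.update_self]
    exact hpred j hjk
  · rw [Function.update_of_ne hjk]
    exact hx j hj hjk

theorem nontrivial_of_forall_ne_mem {S : Set (Fin 3)} (z : Fin 3) (hS : ∀ a ≠ z, a ∈ S) :
    S.Nontrivial :=
  ⟨z + 1, hS _ (by simp), z + 2, hS _ (by simp), by simp⟩

theorem exists_isTwistedColoring_of_eq_univ (hn : 2 ≤ n) (π : Fin n → Equiv.Perm (Fin 3))
    (L : Fin n → Set (Fin 3)) {k i : Fin n} (hk : L k = Set.univ) (hi : (L i).Nonempty)
    (hL : ∀ j ≠ i, (L j).Nontrivial) :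
    ∃ x, IsTwistedColoring π x ∧ ∀ j, x j ∈ L j := by
  obtain ⟨x, hmem, hne⟩ :=
    exists_forall_ne_mem_and_apply_ne π L k i hi fun j hj _ => hL j hj
  obtain ⟨a, hpred, hsucc⟩ : ∃ a, a ≠ π (k - 1) (x (k - 1)) ∧ a ≠ (π k).symm (x (k + 1)) :=
    Fin.exists_ne_and_ne_of_two_lt _ _ (by lia)
  refine ⟨Function.update x k a, isTwistedColoring_update hn (fun j hj _ => hne j hj) ?_ ?_, ?_⟩
  · rintro j rfl
    rw [add_sub_cancel_right] at hpred
    exact hpred.symm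
  · exact fun h => hsucc ((π k).eq_symm_apply.2 h)
  · intro j
    by_cases hj : j = k
    · simp [hj, hk]
    · simpa [hj] using hmem j hj

theorem exists_isTwistedColoring_of_two_values (hn : 3 ≤ n) (π : Fin n → Equiv.Perm (Fin 3))
    {i k : Fin n} (hik : i ≠ k) {p q : Fin 3} (hpq : i + 1 = k → π i p ≠ q)
    (hqp : k + 1 = i → π k q ≠ p) : ∃ x, IsTwistedColoring π x ∧ x i = p ∧ x k = q := by
  let L (j : Fin n) : Set (Fin 3) :=
    {a | (j = i → a = p) ∧ (j + 1 = k → π j a ≠ q) ∧ (j = k + 1 → π k q ≠ a)}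
  have hL (j : Fin n) (hj : j ≠ i) : (L j).Nontrivial := by
    by_cases h : j + 1 = k
    · have hne : j ≠ k + 1 := fun h' => add_one_add_one_ne_self hn j (by rw [h, ← h'])
      exact nontrivial_of_forall_ne_mem ((π j).symm q) fun a ha =>
        ⟨hj.elim, fun _ => mt (π j).eq_symm_apply.2 ha, hne.elim⟩
    · exact nontrivial_of_forall_ne_mem (π k q) fun a ha =>
        ⟨hj.elim, h.elim, fun _ => ha.symm⟩
  obtain ⟨x, hmem, hne⟩ := exists_forall_ne_mem_and_apply_ne π L k i
    ⟨p, fun _ => rfl, fun h => hpq h, fun h => hqp h.symm⟩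
    fun j hj _ => hL j hj
  refine ⟨Function.update x k q, isTwistedColoring_update (by lia) (fun j hj _ => hne j hj) ?_ ?_,
    ?_, by simp⟩
  · exact fun j hj => (hmem j (fun h => add_one_ne_self (by lia) k (h ▸ hj))).2.1 hj
  · exact (hmem (k + 1) (add_one_ne_self (by lia) k)).2.2 rfl
  · simpa [hik] using (hmem i hik).1 rfl

end ListColoring

section FlowerGraph

/-- The strands `u_i`, `v_i`, `w_i` of interchange `i`, indexed by `Fin 3`. -/
def FlowerVertex.strand {n : ℕ} (i : Fin n) : Fin 3 → FlowerVertex n :=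
  ![.u i, .v i, .w i]

variable {n : ℕ}

theorem FlowerVertex.strand_inj {i j : Fin n} {s r : Fin 3} :
    strand i s = strand j r ↔ i = j ∧ s = r := by
  fin_cases s <;> fin_cases r <;> simp [strand]

theorem FlowerVertex.h_ne_strand {i j : Fin n} {s : Fin 3} : .h i ≠ strand j s := by
  fin_cases s <;> simp [strand]

theorem FlowerVertex.eq_h_or_strand (x : FlowerVertex n) :
    (∃ i, x = .h i) ∨ ∃ i s, x = strand i s := by
  cases x with
  | h i => exact .inl ⟨i, rfl⟩
  | u i => exact .inr ⟨i, 0, rfl⟩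
  | v i => exact .inr ⟨i, 1, rfl⟩
  | w i => exact .inr ⟨i, 2, rfl⟩

open FlowerVertex (strand strand_inj h_ne_strand)

variable [NeZero n] {π : Fin n → Equiv.Perm (Fin 3)} {spk lnk : Fin n → Fin 3 → Prop}

/-- The graph formed by the spokes from `h i` to `strand i s` with `spk i s`, and the links from
`strand i s` to `strand (i + 1) (π i s)` with `lnk i s`. -/
def flowerSubgraph (π : Fin n → Equiv.Perm (Fin 3)) (spk lnk : Fin n → Fin 3 → Prop) :
    SimpleGraph (FlowerVertex n) :=
  SimpleGraph.fromRel fun x y => (∃ i s, spk i s ∧ x = .h i ∧ y = strand i s) ∨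
    ∃ i s, lnk i s ∧ x = strand i s ∧ y = strand (i + 1) (π i s)

/-- `(x, y)` is an edge of the twisted flower with twists `π`, oriented away from the hub or towards
the next interchange. -/
def IsFlowerArc (π : Fin n → Equiv.Perm (Fin 3)) (x y : FlowerVertex n) : Prop :=
  (∃ i s, x = .h i ∧ y = strand i s) ∨ ∃ i s, x = strand i s ∧ y = strand (i + 1) (π i s)

/-- The graph built like a Flower snark, where the three links from interchange `i` to the next
one are permuted by `π i`. -/
def twistedFlower (π : Fin n → Equiv.Perm (Fin 3)) : SimpleGraph (FlowerVertex n) :=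
  SimpleGraph.fromRel (IsFlowerArc π)

theorem flowerSubgraph_le_twistedFlower : flowerSubgraph π spk lnk ≤ twistedFlower π := by
  have himp (x y : FlowerVertex n) :
      ((∃ i s, spk i s ∧ x = .h i ∧ y = strand i s) ∨
        ∃ i s, lnk i s ∧ x = strand i s ∧ y = strand (i + 1) (π i s)) → IsFlowerArc π x y :=
    Or.imp (fun ⟨i, s, _, h⟩ => ⟨i, s, h⟩) (fun ⟨i, s, _, h⟩ => ⟨i, s, h⟩)
  exact fun x y hxy => ⟨hxy.1, hxy.2.imp (himp x y) (himp y x)⟩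

theorem flowerSubgraph_adj_h {i : Fin n} {y : FlowerVertex n} :
    (flowerSubgraph π spk lnk).Adj (.h i) y ↔ ∃ s, spk i s ∧ y = strand i s := by
  simp only [flowerSubgraph, SimpleGraph.fromRel_adj]
  constructor
  · rintro ⟨-, (⟨i, s, hs, hi, rfl⟩ | ⟨i, s, -, hi, -⟩) | (⟨i, s, -, -, hi⟩ | ⟨i, s, -, -, hi⟩)⟩
    · obtain rfl := FlowerVertex.h.inj hi
      exact ⟨s, hs, rfl⟩
    all_goals exact (h_ne_strand hi).elim
  · rintro ⟨s, hs, rfl⟩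
    exact ⟨h_ne_strand, .inl (.inl ⟨i, s, hs, rfl, rfl⟩)⟩

theorem flowerSubgraph_adj_strand (hn : 2 ≤ n) {i : Fin n} {s : Fin 3} {y : FlowerVertex n} :
    (flowerSubgraph π spk lnk).Adj (strand i s) y ↔ spk i s ∧ y = .h i ∨
      lnk i s ∧ y = strand (i + 1) (π i s) ∨
      lnk (i - 1) ((π (i - 1)).symm s) ∧ y = strand (i - 1) ((π (i - 1)).symm s) := by
  simp only [flowerSubgraph, SimpleGraph.fromRel_adj]
  constructor
  · rintro ⟨-, (⟨j, r, -, hi, -⟩ | ⟨j, r, hr, hi, rfl⟩) |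
      (⟨j, r, hr, rfl, hi⟩ | ⟨j, r, hr, rfl, hi⟩)⟩
    · exact (h_ne_strand hi.symm).elim
    all_goals obtain ⟨rfl, rfl⟩ := strand_inj.1 hi
    · exact .inr (.inl ⟨hr, rfl⟩)
    · exact .inl ⟨hr, rfl⟩
    · exact .inr (.inr (by simpa using hr))
  · rintro (⟨hs, rfl⟩ | ⟨hs, rfl⟩ | ⟨hs, rfl⟩)
    · exact ⟨h_ne_strand.symm, .inr (.inl ⟨i, s, hs, rfl, rfl⟩)⟩
    · exact ⟨fun h => add_one_ne_self hn i (strand_inj.1 h).1.symm,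
        .inl (.inr ⟨i, s, hs, rfl, rfl⟩)⟩
    · exact ⟨fun h => add_one_ne_self hn i (sub_eq_iff_eq_add.1 (strand_inj.1 h).1.symm).symm,
        .inr (.inr ⟨i - 1, _, hs, rfl, by simp⟩)⟩

/-- The neighbours of `strand i s` in the twisted flower. -/
def strandNeighbors (π : Fin n → Equiv.Perm (Fin 3)) (i : Fin n) (s : Fin 3) :
    Fin 3 → FlowerVertex n :=
  ![.h i, strand (i + 1) (π i s), strand (i - 1) ((π (i - 1)).symm s)]

theorem strandNeighbors_injective (hn : 3 ≤ n) (i : Fin n) (s : Fin 3) :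
    Function.Injective (strandNeighbors π i s) := by
  have hne : i + 1 ≠ i - 1 := fun h => add_one_add_one_ne_self hn i (eq_sub_iff_add_eq.1 h)
  intro j k
  fin_cases j <;> fin_cases k <;>
    simp [strandNeighbors, h_ne_strand, h_ne_strand.symm, strand_inj, hne, hne.symm]

theorem ncard_image_eq_two {α : Type*} {f : Fin 3 → α} (hf : Function.Injective f)
    {S : Set (Fin 3)} {r : Fin 3} (hS : ∀ s, s ∈ S ↔ s ≠ r) : (f '' S).ncard = 2 := by
  obtain rfl : S = {r}ᶜ := Set.ext hS
  rw [Set.ncard_image_of_injective _ hf, Set.ncard_compl]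
  simp

theorem neighborSet_h (i : Fin n) :
    (flowerSubgraph π spk lnk).neighborSet (.h i) = strand i '' {s | spk i s} := by
  ext y
  simp [flowerSubgraph_adj_h, eq_comm (a := y)]

theorem neighborSet_strand (hn : 2 ≤ n) (i : Fin n) (s : Fin 3) :
    (flowerSubgraph π spk lnk).neighborSet (strand i s) = strandNeighbors π i s ''
      {r | ![spk i s, lnk i s, lnk (i - 1) ((π (i - 1)).symm s)] r} := by
  ext y
  simp [flowerSubgraph_adj_strand hn, strandNeighbors, Fin.exists_fin_succ, eq_comm (a := y)]

/-- The complement of the perfect matching of the twisted flower that, for each `i`, has as its only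
link from interchange `i` to the next one the link at `strand i (x i)`. -/
def coloringTwoFactor (π : Fin n → Equiv.Perm (Fin 3)) (x : Fin n → Fin 3) :
    SimpleGraph (FlowerVertex n) :=
  flowerSubgraph π (fun i s => s = x i ∨ s = π (i - 1) (x (i - 1))) fun i s => s ≠ x i

theorem IsTwistedColoring.isTwoFactor (hn : 3 ≤ n) {x : Fin n → Fin 3}
    (hx : IsTwistedColoring π x) : IsTwoFactor (twistedFlower π) (coloringTwoFactor π x) := by
  refine ⟨flowerSubgraph_le_twistedFlower, fun v => ?_⟩
  have hne (i : Fin n) : π (i - 1) (x (i - 1)) ≠ x i := by simpa using hx (i - 1)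
  obtain ⟨i, rfl⟩ | ⟨i, s, rfl⟩ := v.eq_h_or_strand
  · obtain ⟨r, hr⟩ := Fin.exists_ne_and_ne_of_two_lt (x i) (π (i - 1) (x (i - 1))) (by lia)
    rw [coloringTwoFactor, neighborSet_h]
    refine ncard_image_eq_two (fun _ _ h => (strand_inj.1 h).2) (r := r) fun s => ?_
    have := hne i
    rw [Set.mem_ofPred_eq]
    lia
  · rw [coloringTwoFactor, neighborSet_strand (by lia)]
    refine ncard_image_eq_two (strandNeighbors_injective hn i s)
      (r := if s = x i then 1 else if s = π (i - 1) (x (i - 1)) then 2 else 0) fun r => ?_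
    have hi := hne i
    have hsymm : (π (i - 1)).symm s = x (i - 1) ↔ s = π (i - 1) (x (i - 1)) :=
      Equiv.symm_apply_eq _
    fin_cases r <;> simp [hsymm] <;> grind

end FlowerGraph

section FlowerPairs

open FlowerVertex (strand strand_inj h_ne_strand)

variable {n : ℕ} [NeZero n] {π : Fin n → Equiv.Perm (Fin 3)} {x : Fin n → Fin 3}

theorem IsTwistedColoring.not_isGadgetPair (hn : 3 ≤ n) (hx : IsTwistedColoring π x)
    {a b c d : FlowerVertex n} (hab : ¬ (coloringTwoFactor π x).Adj a b)
    (hcd : ¬ (coloringTwoFactor π x).Adj c d) : ¬ IsGadgetPair (twistedFlower π) a b c d :=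
  fun hg => hg.not_avoid _ (hx.isTwoFactor hn) ⟨hab, hcd⟩

theorem not_coloringTwoFactor_adj_link (hn : 3 ≤ n) (i : Fin n) :
    ¬ (coloringTwoFactor π x).Adj (strand i (x i)) (strand (i + 1) (π i (x i))) := by
  have hne : i + 1 ≠ i - 1 := fun h => add_one_add_one_ne_self hn i (eq_sub_iff_add_eq.1 h)
  simp [coloringTwoFactor, flowerSubgraph_adj_strand (show 2 ≤ n by lia), strand_inj,
    h_ne_strand.symm, hne]

/-- The colours at `j` for which, in the matching of a twisted colouring, no link at `j` meets the
spoke from `h i` to `strand i s`. -/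
def spokeList (π : Fin n → Equiv.Perm (Fin 3)) (i : Fin n) (s : Fin 3) (j : Fin n) :
    Set (Fin 3) :=
  {a | (j = i → a ≠ s) ∧ (j + 1 = i → π j a ≠ s)}

theorem spokeList_nontrivial (hn : 2 ≤ n) (i : Fin n) (s : Fin 3) (j : Fin n) :
    (spokeList π i s j).Nontrivial := by
  by_cases h : j = i
  · exact nontrivial_of_forall_ne_mem s fun a ha =>
      ⟨fun _ => ha, fun h' => (add_one_ne_self hn i (h ▸ h')).elim⟩
  · exact nontrivial_of_forall_ne_mem ((π j).symm s) fun a ha =>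
      ⟨h.elim, fun _ => mt (π j).eq_symm_apply.2 ha⟩

theorem spokeList_eq_univ {i j : Fin n} {s : Fin 3} (hj : j ≠ i) (hj' : j + 1 ≠ i) :
    spokeList π i s j = Set.univ :=
  Set.eq_univ_of_forall fun _ => ⟨hj.elim, hj'.elim⟩

theorem not_coloringTwoFactor_adj_spoke {i : Fin n} {s : Fin 3}
    (hx : ∀ j, x j ∈ spokeList π i s j) : ¬ (coloringTwoFactor π x).Adj (.h i) (strand i s) := by
  rw [coloringTwoFactor, flowerSubgraph_adj_h]
  rintro ⟨r, hr, hs⟩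
  obtain rfl := (strand_inj.1 hs).2
  obtain rfl | rfl := hr
  · exact (hx i).1 rfl rfl
  · exact (hx (i - 1)).2 (sub_add_cancel i 1) rfl

theorem spokeList_inter_nonempty (hn : 2 ≤ n) {i k : Fin n} (hik : i ≠ k) {s r : Fin 3} :
    (spokeList π i s k ∩ spokeList π k r k).Nonempty := by
  obtain ⟨a, ha, ha'⟩ := Fin.exists_ne_and_ne_of_two_lt ((π k).symm s) r (by lia)
  exact ⟨a, ⟨fun h => (hik h.symm).elim, fun _ => mt (π k).eq_symm_apply.2 ha⟩,
    fun _ => ha', fun h => (add_one_ne_self hn k h).elim⟩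

theorem exists_notMem_of_card_lt_card {α : Type*} [Fintype α] (S : Finset α)
    (hS : S.card < Fintype.card α) : ∃ a, a ∉ S := by
  simpa using Finset.exists_mem_notMem_of_card_lt_card (t := Finset.univ) hS

theorem not_isGadgetPair_spoke_spoke (hn : 5 ≤ n) {i k : Fin n} {s r : Fin 3} (hik : i ≠ k) :
    ¬ IsGadgetPair (twistedFlower π) (.h i) (strand i s) (.h k) (strand k r) := by
  obtain ⟨m, hm⟩ : ∃ m, m ∉ ({i, i - 1, k, k - 1} : Finset (Fin n)) :=
    exists_notMem_of_card_lt_card _ (Finset.card_le_four.trans_lt (by simpa))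
  simp only [Finset.mem_insert, Finset.mem_singleton, not_or, eq_sub_iff_add_eq] at hm
  have hL (j : Fin n) (hj : ¬ ((j = i ∨ j + 1 = i) ∧ (j = k ∨ j + 1 = k))) :
      (spokeList π i s j ∩ spokeList π k r j).Nontrivial := by
    obtain h | h := not_and_or.1 hj <;> rw [not_or] at h
    · rw [spokeList_eq_univ h.1 h.2, Set.univ_inter]
      exact spokeList_nontrivial (by lia) k r j
    · rw [spokeList_eq_univ h.1 h.2, Set.inter_univ]
      exact spokeList_nontrivial (by lia) i s j
  have hconsec : ¬ (i + 1 = k ∧ k + 1 = i) := fun h =>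
    add_one_add_one_ne_self (by lia) i (by rw [h.1, h.2])
  have hsingle : (spokeList π i s (if i + 1 = k then i else k) ∩
      spokeList π k r (if i + 1 = k then i else k)).Nonempty := by
    split_ifs
    · exact Set.inter_comm _ _ ▸ spokeList_inter_nonempty (by lia) hik.symm
    · exact spokeList_inter_nonempty (by lia) hik
  obtain ⟨x, hx, hmem⟩ := exists_isTwistedColoring_of_eq_univ (by lia) π
    (fun j => spokeList π i s j ∩ spokeList π k r j) (k := m) (i := if i + 1 = k then i else k)
    (by rw [spokeList_eq_univ hm.1 hm.2.1, spokeList_eq_univ hm.2.2.1 hm.2.2.2, Set.univ_inter])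
    hsingle fun j hj => hL j (by grind)
  exact hx.not_isGadgetPair (by lia) (not_coloringTwoFactor_adj_spoke fun j => (hmem j).1)
    (not_coloringTwoFactor_adj_spoke fun j => (hmem j).2)

theorem not_isGadgetPair_spoke_link (hn : 5 ≤ n) {i k : Fin n} {s q : Fin 3}
    (hik : strand i s ≠ strand k q) (hik' : strand i s ≠ strand (k + 1) (π k q)) :
    ¬ IsGadgetPair (twistedFlower π) (.h i) (strand i s) (strand k q)
      (strand (k + 1) (π k q)) := by
  obtain ⟨m, hm⟩ : ∃ m, m ∉ ({i, i - 1, k} : Finset (Fin n)) :=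
    exists_notMem_of_card_lt_card _ (Finset.card_le_three.trans_lt (by simp; lia))
  simp only [Finset.mem_insert, Finset.mem_singleton, not_or, eq_sub_iff_add_eq] at hm
  let L (j : Fin n) : Set (Fin 3) := {a | a ∈ spokeList π i s j ∧ (j = k → a = q)}
  have hq : q ∈ L k := ⟨⟨fun h h' => hik (by rw [h, h']), fun h h' => hik' (by rw [h, h'])⟩,
    fun _ => rfl⟩
  have hL (j : Fin n) (hj : j ≠ k) : (L j).Nontrivial :=
    (spokeList_nontrivial (by lia) i s j).mono fun a ha => ⟨ha, hj.elim⟩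
  have hm : L m = Set.univ := Set.eq_univ_of_forall fun a =>
    ⟨spokeList_eq_univ hm.1 hm.2.1 ▸ trivial, hm.2.2.elim⟩
  obtain ⟨x, hx, hmem⟩ := exists_isTwistedColoring_of_eq_univ (by lia) π L hm ⟨q, hq⟩ hL
  obtain rfl := (hmem k).2 rfl
  exact hx.not_isGadgetPair (by lia)
    (not_coloringTwoFactor_adj_spoke fun j => (hmem j).1)
    (not_coloringTwoFactor_adj_link (by lia) k)

theorem not_isGadgetPair_link_link (hn : 3 ≤ n) {i k : Fin n} {p q : Fin 3} (hik : i ≠ k)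
    (hpq : strand (i + 1) (π i p) ≠ strand k q) (hqp : strand i p ≠ strand (k + 1) (π k q)) :
    ¬ IsGadgetPair (twistedFlower π) (strand i p) (strand (i + 1) (π i p)) (strand k q)
      (strand (k + 1) (π k q)) := by
  obtain ⟨x, hx, rfl, rfl⟩ := exists_isTwistedColoring_of_two_values hn π hik
    (fun h h' => hpq (by rw [h, h'])) (fun h h' => hqp (by rw [h, h']))
  exact hx.not_isGadgetPair hn (not_coloringTwoFactor_adj_link hn i)
    (not_coloringTwoFactor_adj_link hn k)

end FlowerPairs

section PendantTriangle

variable {V : Type*} {R H : SimpleGraph V} {a b c d h : V}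

theorem ncard_neighborSet_sup_edge (hac : a ≠ c) (hHac : ¬ H.Adj a c)
    (ha : (H.neighborSet a).ncard = 1) :
    ((H ⊔ SimpleGraph.edge a c).neighborSet a).ncard = 2 := by
  have hinsert : (H ⊔ SimpleGraph.edge a c).neighborSet a = insert c (H.neighborSet a) := by
    ext w
    simp only [SimpleGraph.mem_neighborSet, SimpleGraph.sup_adj, SimpleGraph.edge_adj,
      Set.mem_insert_iff]
    grind
  have hfin : (H.neighborSet a).Finite := Set.finite_of_ncard_ne_zero (ha ▸ one_ne_zero)
  rw [hinsert, Set.ncard_insert_of_notMem (by exact hHac) hfin, ha]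

theorem isTwoFactor_sup_edge (hHR : H ≤ R) (hac : R.Adj a c) (hHac : ¬ H.Adj a c)
    (ha : (H.neighborSet a).ncard = 1) (hc : (H.neighborSet c).ncard = 1)
    (hH : ∀ v, v ≠ a → v ≠ c → (H.neighborSet v).ncard = 2) :
    IsTwoFactor R (H ⊔ SimpleGraph.edge a c) := by
  refine ⟨sup_le hHR ((SimpleGraph.edge_le_iff _).2 (.inr hac)), fun v => ?_⟩
  by_cases hva : v = a
  · rw [hva]
    exact ncard_neighborSet_sup_edge hac.ne hHac ha
  by_cases hvc : v = c
  · rw [hvc, SimpleGraph.edge_comm]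
    exact ncard_neighborSet_sup_edge hac.ne.symm (hHac ∘ .symm) hc
  · have hsame : (H ⊔ SimpleGraph.edge a c).neighborSet v = H.neighborSet v := by
      ext w
      simp [SimpleGraph.edge_adj, hva, hvc]
    rw [hsame, hH v hva hvc]

theorem exists_isCycle_length_eq_three (hac : R.Adj a c) (hch : R.Adj c h) (hha : R.Adj h a) :
    ∃ p : R.Walk a a, p.IsCycle ∧ p.length = 3 ∧ s(a, c) ∈ p.edges := by
  refine ⟨.cons hac (.cons hch (.cons hha .nil)), ?_, rfl, by simp⟩
  simp [SimpleGraph.Walk.cons_isCycle_iff, hac.ne, hac.ne.symm, hch.ne, hha.ne, hha.ne.symm]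

theorem not_isGadgetPair_of_pendant_triangle (hHR : H ≤ R) (ha : H.neighborSet a = {h})
    (hc : H.neighborSet c = {h}) (hbh : b ≠ h) (hdh : d ≠ h) (hbd : ¬ H.Adj b d)
    (hH : ∀ v, v ≠ a → v ≠ c → (H.neighborSet v).ncard = 2) : ¬ IsGadgetPair R a b c d := by
  intro hg
  have hac : a ≠ c := hg.independent.1
  have adj_a {v : V} : H.Adj a v ↔ v = h := Set.ext_iff.1 ha v
  have adj_c {v : V} : H.Adj c v ↔ v = h := Set.ext_iff.1 hc v
  have hne : a ≠ h := (adj_a.2 rfl).ne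
  have hnotmem (e : Sym2 V) (he : e ∈ H.edgeSet) :
      e ≠ s(a, b) ∧ e ≠ s(c, d) ∧ e ∉ crossEdges a b c d := by
    simp only [crossEdges, Set.mem_insert_iff, Set.mem_singleton_iff, not_or]
    refine ⟨?_, ?_, ?_, ?_, ?_, ?_⟩ <;> rintro rfl <;> rw [SimpleGraph.mem_edgeSet] at he
    · exact hbh (adj_a.1 he)
    · exact hdh (adj_c.1 he)
    · exact hne (adj_c.1 he.symm)
    · exact hdh (adj_a.1 he)
    · exact hbh (adj_c.1 he.symm)
    · exact hbd he
  have hcross : s(a, c) ∈ crossEdges a b c d := .inl rfl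
  have hle : H ≤ exchange R a b c d := fun v w hvw =>
    exchange_adj.2 (.inl ⟨hHR hvw, (hnotmem _ hvw).1, (hnotmem _ hvw).2.1⟩)
  have hF := isTwoFactor_sup_edge hle (exchange_adj.2 (.inr ⟨hcross, hac⟩))
    (fun h => (hnotmem _ h).2.2 hcross) (ha ▸ Set.ncard_singleton h) (hc ▸ Set.ncard_singleton h) hH
  have hinter : (H ⊔ SimpleGraph.edge a c).edgeSet ∩ crossEdges a b c d = {s(a, c)} := by
    rw [SimpleGraph.edgeSet_sup, SimpleGraph.edgeSet_edge_of_ne hac, Set.union_inter_distrib_right,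
      Set.singleton_inter_of_mem hcross, Set.union_eq_right]
    exact fun e he => ((hnotmem e he.1).2.2 he.2).elim
  obtain ⟨p, hp, hlen, hmem⟩ := exists_isCycle_length_eq_three
    (show (H ⊔ SimpleGraph.edge a c).Adj a c from .inr ((SimpleGraph.adj_edge ..).2 ⟨rfl, hac⟩))
    (.inl (adj_c.2 rfl)) (.inl (adj_a.2 rfl).symm)
  have heven : Even p.length := (hg.cross _ hF _ hinter a p hp).1 hmem
  rw [hlen] at heven
  exact absurd heven (by decide)

end PendantTriangle

section SameGap

variable {α : Type*} {n : ℕ} [NeZero n]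

open FlowerVertex (strand strand_inj h_ne_strand)

/-- `D` is a set of gaps alternating around the cycle, except that the gaps on both sides of
interchange `i` are in `D`, and `t` selects a strand of each interchange such that the selected
strands on both sides of a gap in `D` are linked. Gap `j` is the one between `j` and `j + 1`. -/
structure IsAlternating (π : Fin n → Equiv.Perm α) (i : Fin n) (D : Set (Fin n)) (t : Fin n → α) :
    Prop where
  mem : i ∈ D
  sub_one_mem : i - 1 ∈ D
  mem_iff : ∀ j ≠ i, j ∈ D ↔ j - 1 ∉ D
  apply_eq : ∀ j ∈ D, π j (t j) = t (j + 1)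

theorem exists_isAlternating (hn : Odd n) (hn2 : 2 ≤ n) (π : Fin n → Equiv.Perm α) (i : Fin n)
    (a : α) : ∃ D t, IsAlternating π i D t ∧ t i = a := by
  classical
  let D : Set (Fin n) := {j | Even (j - i).val}
  have hD (j : Fin n) (hj : j ≠ i) : j ∈ D ↔ j - 1 ∉ D := by
    have h : j - 1 - i + 1 = j - i := by abel
    have hval : (j - i).val = (j - 1 - i).val + 1 := by
      rw [← h]
      exact val_add_one_of_add_one_ne_zero (h ▸ sub_ne_zero.2 hj)
    simp only [D, Set.mem_ofPred_eq, hval, Nat.even_add_one]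
  have hi' : i - 1 ∈ D := by
    obtain ⟨m, rfl⟩ := hn
    simp [D]
  let start (j : Fin n) : α := if j = i - 1 then (π j).symm a else a
  refine ⟨D, fun j => if j ∈ D ∨ j = i then start j else π (j - 1) (start (j - 1)),
    ⟨by simp [D], hi', hD, fun j hj => ?_⟩, ?_⟩
  · by_cases hji : j + 1 = i
    · subst hji
      simp [hj, start, add_one_ne_self hn2]
    · have hj' : j + 1 ∉ D := by simpa [hj] using (hD (j + 1) hji).not
      simp [hj, hj', hji]
  · simp only [start]
    simp [eq_sub_iff_add_eq, add_one_ne_self hn2]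

/-- The subgraph that has one link, namely the selected one, in each gap of `D`, the two others in
each remaining gap, and the spokes to the strands that are not selected. -/
def alternatingSubgraph (π : Fin n → Equiv.Perm (Fin 3)) (D : Set (Fin n)) (t : Fin n → Fin 3) :
    SimpleGraph (FlowerVertex n) :=
  flowerSubgraph π (fun j s => s ≠ t j) fun j s => j ∈ D → s = t j

namespace IsAlternating

variable {π : Fin n → Equiv.Perm (Fin 3)} {i : Fin n} {D : Set (Fin n)} {t : Fin n → Fin 3}

theorem symm_apply_eq_iff (h : IsAlternating π i D t) {j : Fin n} (hj : j - 1 ∈ D) (s : Fin 3) :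
    (π (j - 1)).symm s = t (j - 1) ↔ s = t j := by
  rw [Equiv.symm_apply_eq, h.apply_eq _ hj, sub_add_cancel]

theorem neighborSet_strand_of_ne (h : IsAlternating π i D t) (hn : 2 ≤ n) {s : Fin 3}
    (hs : s ≠ t i) : (alternatingSubgraph π D t).neighborSet (strand i s) = {.h i} := by
  ext y
  simp [alternatingSubgraph, flowerSubgraph_adj_strand hn, h.mem, h.sub_one_mem, hs,
    h.symm_apply_eq_iff]

theorem ncard_neighborSet (h : IsAlternating π i D t) (hn : 3 ≤ n) {v : FlowerVertex n}
    (hv : ∀ s ≠ t i, v ≠ strand i s) : ((alternatingSubgraph π D t).neighborSet v).ncard = 2 := by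
  obtain ⟨j, rfl⟩ | ⟨j, s, rfl⟩ := v.eq_h_or_strand
  · rw [alternatingSubgraph, neighborSet_h]
    exact ncard_image_eq_two (fun _ _ h => (strand_inj.1 h).2) fun s => Iff.rfl
  rw [alternatingSubgraph, neighborSet_strand (by lia)]
  by_cases hs : s = t j
  · refine ncard_image_eq_two (strandNeighbors_injective hn j s) (r := 0) fun r => ?_
    fin_cases r <;> simp +contextual [hs, h.symm_apply_eq_iff]
  have hji : j ≠ i := by
    rintro rfl
    exact hv s hs rfl
  have hback : (j - 1 ∈ D → (π (j - 1)).symm s = t (j - 1)) ↔ j ∈ D := by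
    rw [h.mem_iff j hji]
    exact forall_congr' fun hj => by simp [h.symm_apply_eq_iff hj, hs]
  by_cases hj : j ∈ D
  · refine ncard_image_eq_two (strandNeighbors_injective hn j s) (r := 1) fun r => ?_
    fin_cases r <;> simp [hs, hback, hj]
  · refine ncard_image_eq_two (strandNeighbors_injective hn j s) (r := 2) fun r => ?_
    fin_cases r <;> simp [hs, hback, hj]

end IsAlternating

theorem not_isGadgetPair_same_gap {π : Fin n → Equiv.Perm (Fin 3)} (hn : Odd n) (hn3 : 3 ≤ n)
    {i : Fin n} {p q : Fin 3} (hpq : p ≠ q) :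
    ¬ IsGadgetPair (twistedFlower π) (strand i p) (strand (i + 1) (π i p)) (strand i q)
      (strand (i + 1) (π i q)) := by
  obtain ⟨r, hrp, hrq⟩ := Fin.exists_ne_and_ne_of_two_lt p q (by lia)
  obtain ⟨D, t, h, rfl⟩ := exists_isAlternating hn (by lia) π i r
  refine not_isGadgetPair_of_pendant_triangle flowerSubgraph_le_twistedFlower
    (h.neighborSet_strand_of_ne (by lia) hrp.symm) (h.neighborSet_strand_of_ne (by lia) hrq.symm)
    h_ne_strand.symm h_ne_strand.symm ?_ fun v hvp hvq => h.ncard_neighborSet hn3 fun s hs => ?_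
  · simp [flowerSubgraph_adj_strand (show 2 ≤ n by lia), strand_inj,
      h_ne_strand.symm, show n ≠ 1 by lia]
  · obtain rfl | rfl : s = p ∨ s = q := by lia
    exacts [hvp, hvq]

end SameGap

section FlowerSnark

open FlowerVertex (strand strand_inj h_ne_strand)

variable {n : ℕ} [NeZero n]

theorem not_isGadgetPair_of_isFlowerArc {π : Fin n → Equiv.Perm (Fin 3)} (hn : Odd n) (hn5 : 5 ≤ n)
    {a b c d : FlowerVertex n} (hab : IsFlowerArc π a b) (hcd : IsFlowerArc π c d) :
    ¬ IsGadgetPair (twistedFlower π) a b c d := by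
  intro hg
  obtain ⟨hac, had, hbc, hbd⟩ := hg.independent
  obtain ⟨i, s, rfl, rfl⟩ | ⟨i, p, rfl, rfl⟩ := hab <;>
    obtain ⟨k, r, rfl, rfl⟩ | ⟨k, q, rfl, rfl⟩ := hcd
  · exact not_isGadgetPair_spoke_spoke hn5 (mt (congrArg _) hac) hg
  · exact not_isGadgetPair_spoke_link hn5 hbc hbd hg
  · exact not_isGadgetPair_spoke_link hn5 had.symm hbd.symm hg.symm
  · by_cases hik : i = k
    · subst hik
      exact not_isGadgetPair_same_gap hn (by lia) (mt (congrArg _) hac) hg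
    · exact not_isGadgetPair_link_link (by lia) hik hbc had hg

theorem not_hasGadgetPair_twistedFlower (π : Fin n → Equiv.Perm (Fin 3)) (hn : Odd n)
    (hn5 : 5 ≤ n) : ¬ HasGadgetPair (twistedFlower π) := by
  rintro ⟨a, b, c, d, hg⟩
  obtain ⟨-, hab | hab⟩ := hg.adj_ab <;> obtain ⟨-, hcd | hcd⟩ := hg.adj_cd
  · exact not_isGadgetPair_of_isFlowerArc hn hn5 hab hcd hg
  · exact not_isGadgetPair_of_isFlowerArc hn hn5 hab hcd hg.swap_right
  · exact not_isGadgetPair_of_isFlowerArc hn hn5 hab hcd hg.swap_left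
  · exact not_isGadgetPair_of_isFlowerArc hn hn5 hab hcd hg.swap_left.swap_right

/-- The twists of the Flower snark: the links from the last interchange to the first one exchange
the strands `u` and `v`. -/
def flowerTwist (n : ℕ) (i : Fin n) : Equiv.Perm (Fin 3) :=
  if i.val + 1 = n then Equiv.swap 0 1 else 1

theorem add_one_eq_iff {i j : Fin n} :
    i + 1 = j ↔ i.val + 1 = j.val ∨ i.val + 1 = n ∧ j.val = 0 := by
  rw [← Fin.val_inj, Fin.val_add, Fin.val_one', Nat.add_mod_mod]
  obtain hi | hi := (show i.val + 1 ≤ n from i.isLt).lt_or_eq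
  · rw [Nat.mod_eq_of_lt hi]
    lia
  · rw [hi, Nat.mod_self]
    lia

theorem FlowerEdge.isFlowerArc {x y : FlowerVertex n} (h : FlowerEdge n x y) :
    IsFlowerArc (flowerTwist n) x y := by
  have link {i j : Fin n} (s : Fin 3) (hij : i + 1 = j) :
      IsFlowerArc (flowerTwist n) (strand i s) (strand j (flowerTwist n i s)) :=
    .inr ⟨i, s, rfl, by rw [hij]⟩
  have hone {i j : Fin n} (hij : i.val + 1 = j.val) : flowerTwist n i = 1 :=
    if_neg (hij ▸ j.isLt.ne)
  obtain i | i | i | ⟨i, j, h⟩ | ⟨i, j, h⟩ | ⟨i, j, h⟩ | ⟨i, j, hi, hj⟩ | ⟨i, j, hi, hj⟩ |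
    ⟨i, j, hi, hj⟩ := h
  · exact .inl ⟨i, 0, rfl, rfl⟩
  · exact .inl ⟨i, 1, rfl, rfl⟩
  · exact .inl ⟨i, 2, rfl, rfl⟩
  · simpa [hone h, strand] using link 0 (add_one_eq_iff.2 (.inl h))
  · simpa [hone h, strand] using link 1 (add_one_eq_iff.2 (.inl h))
  · simpa [hone h, strand] using link 2 (add_one_eq_iff.2 (.inl h))
  · simpa [flowerTwist, hi, strand] using link 0 (add_one_eq_iff.2 (.inr ⟨hi, hj⟩))
  · simpa [flowerTwist, hi, strand] using link 1 (add_one_eq_iff.2 (.inr ⟨hi, hj⟩))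
  · simpa [flowerTwist, hi, strand, Equiv.swap_apply_of_ne_of_ne] using
      link 2 (add_one_eq_iff.2 (.inr ⟨hi, hj⟩))

theorem flowerEdge_iff_isFlowerArc {x y : FlowerVertex n} :
    FlowerEdge n x y ↔ IsFlowerArc (flowerTwist n) x y := by
  refine ⟨FlowerEdge.isFlowerArc, ?_⟩
  rintro (⟨i, s, rfl, rfl⟩ | ⟨i, s, rfl, rfl⟩)
  · fin_cases s
    exacts [.hu i, .hv i, .hw i]
  obtain h | ⟨hi, hj⟩ := add_one_eq_iff.1 (rfl : i + 1 = i + 1)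
  · have hone : flowerTwist n i = 1 := if_neg (h ▸ (i + 1).isLt.ne)
    rw [hone]
    fin_cases s
    exacts [.uu _ _ h, .vv _ _ h, .ww _ _ h]
  · have hswap : flowerTwist n i = Equiv.swap 0 1 := if_pos hi
    rw [hswap]
    fin_cases s
    exacts [.uv _ _ hi hj, .vu _ _ hi hj, .wrap _ _ hi hj]

theorem flowerSnark_eq_twistedFlower : flowerSnark n = twistedFlower (flowerTwist n) :=
  congrArg _ (funext₂ fun _ _ => propext flowerEdge_iff_isFlowerArc)

end FlowerSnark

end OddTwoFactor

theorem lemma5p2 :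
    (¬ OddTwoFactor.HasGadgetPair OddTwoFactor.P18 ∧
      ¬ OddTwoFactor.HasGadgetPair OddTwoFactor.P26 ∧
      ¬ OddTwoFactor.HasGadgetPair OddTwoFactor.P34) ∧
    (∀ t : ℕ, Odd t → 5 ≤ t → ¬ OddTwoFactor.HasGadgetPair (OddTwoFactor.flowerSnark t)) := by
  refine ⟨⟨OddTwoFactor.not_hasGadgetPair_P18, OddTwoFactor.not_hasGadgetPair_P26,
    OddTwoFactor.not_hasGadgetPair_P34⟩, fun t hodd ht => ?_⟩
  have : NeZero t := ⟨by lia⟩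
  rw [OddTwoFactor.flowerSnark_eq_twistedFlower]
  exact OddTwoFactor.not_hasGadgetPair_twistedFlower _ hodd ht
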